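/- Let $G$ be a finite simple graph with $n$ vertices and $m$ edges, given by adjacency lists (in any order). Consider the following leaf-removal algorithm. Mark all $n$ vertices as present, put the leaves (vertices of degree $1$) of $G$ into a queue, and set $M=\emptyset$. As long as the queue is non-empty, take its first vertex $v$; if $v$ is still present and is a leaf of the current graph (the subgraph induced by the present vertices), with neighbour $u$, say, then remove $v$ and $u$ from the graph, add the edge $vu$ to $M$, and append to the queue all those neighbours of $u$ that have become leaves of the current graph by this removal. At the end, answer "yes" if no vertex is left, and "no" otherwise. Call $G$ a König–Egerváry graph if $\alpha(G)+\mu(G)=n$, where $\alpha(G)$ is the largest size of an independent set and $\mu(G)$ the largest size of a matching of $G$. Theorem. For every König–Egerváry graph $G$ the algorithm terminates; it answers "yes" if and only if $G$ has a unique perfect matching, and in that case $M$ is this perfect matching. On a random access machine with unit cost, whose only arithmetic operations are adding one and subtraction, it takes $O(n+m+1)$ steps; in particular it takes $O(m)$ steps if $G$ has no isolated vertices and $m\ge 1$. The implied constants are absolute. -/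

import Mathlib

namespace UPM

/-! ### König–Egerváry graphs -/

/-- The matching number: the largest number of edges of a matching. (A matching is a subgraph
all of whose vertices have exactly one neighbour in the subgraph.) -/
noncomputable def matchingNum {V : Type*} (G : SimpleGraph V) : ℕ :=
  sSup {k | ∃ M : G.Subgraph, M.IsMatching ∧ M.edgeSet.ncard = k}

/-- A graph is a König–Egerváry graph if its independence number and its matching number add
up to its number of vertices. -/
def IsKonigEgervary {V : Type*} (G : SimpleGraph V) : Prop :=
  G.indepNum + matchingNum G = Nat.card V

/-- `G` has exactly one perfect matching. -/
def HasUniquePerfectMatching {V : Type*} (G : SimpleGraph V) : Prop :=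
  ∃! M : G.Subgraph, M.IsPerfectMatching

/-! ### The machine: structured programs on a random access memory, with a step count

The memory consists of finitely many registers (named by `R`) and finitely many arrays (named by
`A`), all holding natural numbers. The only arithmetic is adding one and (truncated) subtraction,
so a single step increases the largest number in use by at most one. -/

/-- The contents of the memory. -/
structure Store (R A : Type) where
  reg : R → ℕ
  arr : A → ℕ → ℕ

/-- Arithmetic expressions. -/
inductive Expr (R A : Type) : Type where
  | lit : ℕ → Expr R A
  | reg : R → Expr R A
  | read : A → Expr R A → Expr R A
  | succ : Expr R A → Expr R A
  | sub : Expr R A → Expr R A → Expr R A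

/-- Tests. -/
inductive Test (R A : Type) : Type where
  | eq : Expr R A → Expr R A → Test R A
  | lt : Expr R A → Expr R A → Test R A
  | and : Test R A → Test R A → Test R A

/-- Programs: assignment to a register, assignment `a[e₁] := e₂` to an array cell, composition,
one-armed conditional, loop. -/
inductive Prog (R A : Type) : Type where
  | set : R → Expr R A → Prog R A
  | write : A → Expr R A → Expr R A → Prog R A
  | seq : Prog R A → Prog R A → Prog R A
  | ifThen : Test R A → Prog R A → Prog R A
  | while : Test R A → Prog R A → Prog R A

section Semantics

variable {R A : Type}

/-- Value of an expression. -/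
def Expr.eval (s : Store R A) : Expr R A → ℕ
  | .lit k => k
  | .reg r => s.reg r
  | .read a e => s.arr a (e.eval s)
  | .succ e => e.eval s + 1
  | .sub e f => e.eval s - f.eval s

/-- Number of steps for evaluating an expression: one for each symbol in it. -/
def Expr.cost : Expr R A → ℕ
  | .lit _ => 1
  | .reg _ => 1
  | .read _ e => e.cost + 1
  | .succ e => e.cost + 1
  | .sub e f => e.cost + f.cost + 1

/-- Truth of a test. -/
def Test.holds (s : Store R A) : Test R A → Prop
  | .eq e f => e.eval s = f.eval s
  | .lt e f => e.eval s < f.eval s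
  | .and b c => b.holds s ∧ c.holds s

/-- Number of steps for evaluating a test: one for each symbol in it. -/
def Test.cost : Test R A → ℕ
  | .eq e f => e.cost + f.cost + 1
  | .lt e f => e.cost + f.cost + 1
  | .and b c => b.cost + c.cost + 1

/-- Assignment to a register. -/
def Store.setReg [DecidableEq R] (s : Store R A) (r : R) (x : ℕ) : Store R A :=
  { s with reg := Function.update s.reg r x }

/-- Assignment to an array cell. -/
def Store.setArr [DecidableEq A] (s : Store R A) (a : A) (i x : ℕ) : Store R A :=
  { s with arr := Function.update s.arr a (Function.update (s.arr a) i x) }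

/-- `Exec p s t s'`: the program `p`, started with memory `s`, halts after exactly `t` steps, and
then the memory is `s'`. -/
inductive Exec [DecidableEq R] [DecidableEq A] :
    Prog R A → Store R A → ℕ → Store R A → Prop where
  | set (s : Store R A) (r : R) (e : Expr R A) :
      Exec (.set r e) s (e.cost + 1) (s.setReg r (e.eval s))
  | write (s : Store R A) (a : A) (e f : Expr R A) :
      Exec (.write a e f) s (e.cost + f.cost + 1) (s.setArr a (e.eval s) (f.eval s))
  | seq {p q : Prog R A} {s s₁ s₂ : Store R A} {t₁ t₂ : ℕ} :
      Exec p s t₁ s₁ → Exec q s₁ t₂ s₂ → Exec (.seq p q) s (t₁ + t₂) s₂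
  | ifTrue {b : Test R A} {p : Prog R A} {s s₁ : Store R A} {t : ℕ} :
      b.holds s → Exec p s t s₁ → Exec (.ifThen b p) s (b.cost + t) s₁
  | ifFalse {b : Test R A} {p : Prog R A} {s : Store R A} :
      ¬ b.holds s → Exec (.ifThen b p) s b.cost s
  | whileTrue {b : Test R A} {p : Prog R A} {s s₁ s₂ : Store R A} {t₁ t₂ : ℕ} :
      b.holds s → Exec p s t₁ s₁ → Exec (.while b p) s₁ t₂ s₂ →
      Exec (.while b p) s (b.cost + t₁ + t₂) s₂
  | whileFalse {b : Test R A} {p : Prog R A} {s : Store R A} :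
      ¬ b.holds s → Exec (.while b p) s b.cost s

end Semantics

/-! ### The algorithm -/

/-- The registers of the program: `n` is the number of vertices (input), `ans` the answer, `k`
the number of edges in the matching found so far, `front` and `back` the two ends of the queue. -/
inductive Reg : Type where
  | n | ans | k | front | back | i | j | u | v | w
  deriving DecidableEq

/-- The arrays of the program. Input: the neighbours of `v` are the entries of `adj` at the
positions from `start[v]` (inclusive) to `start[v+1]` (exclusive). Work space: `vertex[v] = 1` if
`v` still belongs to the current graph and `vertex[v] = 0` if not, `deg` holds the degrees in the
current graph, `queue` the queue of leaves. Output: the `i`-th edge of the matching joins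
`fst[i]` and `snd[i]`. -/
inductive Arr : Type where
  | start | adj | vertex | deg | queue | fst | snd
  deriving DecidableEq

/-- Sequential composition. -/
infixr:40 " ;; " => Prog.seq

/-- The value of a register, as an expression. -/
abbrev get (r : Reg) : Expr Reg Arr := .reg r

/-- An array cell, as an expression. -/
abbrev cell (a : Arr) (e : Expr Reg Arr) : Expr Reg Arr := .read a e

/-- `r := r + 1` -/
abbrev incr (r : Reg) : Prog Reg Arr := .set r (.succ (get r))

/-- Append the vertex in register `r` to the queue. -/
def enqueue (r : Reg) : Prog Reg Arr :=
  .write .queue (get .back) (get r) ;;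
  incr .back

/-- `for i = 0, …, n - 1 do body` -/
def forVertices (body : Prog Reg Arr) : Prog Reg Arr :=
  .set .i (.lit 0) ;;
  .while (.lt (get .i) (get .n)) (
    body ;;
    incr .i)

/-- For all vertices `w` of the current graph that are neighbours, in the original graph, of the
vertex in register `r`, do `body`. -/
def forNeighbours (r : Reg) (body : Prog Reg Arr) : Prog Reg Arr :=
  .set .j (cell .start (get r)) ;;
  .while (.lt (get .j) (cell .start (.succ (get r)))) (
    .set .w (cell .adj (get .j)) ;;
    .ifThen (.eq (cell .vertex (get .w)) (.lit 1)) body ;;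
    incr .j)

/-- Mark all the vertices as present. -/
def initVertices : Prog Reg Arr :=
  forVertices (.write .vertex (get .i) (.lit 1))

/-- Compute the degrees, and put the leaves of the graph into the queue. -/
def initLeaves : Prog Reg Arr :=
  .set .front (.lit 0) ;;
  .set .back (.lit 0) ;;
  forVertices (
    .write .deg (get .i) (.sub (cell .start (.succ (get .i))) (cell .start (get .i))) ;;
    .ifThen (.eq (cell .deg (get .i)) (.lit 1)) (enqueue .i))

/-- With `v` a leaf of the current graph: let `u` be its neighbour, remove `v` and `u` from the
graph, add the edge `vu` to the matching, and put the neighbours of `u` that have just become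
leaves into the queue. -/
def removeLeaf : Prog Reg Arr :=
  forNeighbours .v (.set .u (get .w)) ;;
  .write .vertex (get .v) (.lit 0) ;;
  .write .vertex (get .u) (.lit 0) ;;
  .write .fst (get .k) (get .v) ;;
  .write .snd (get .k) (get .u) ;;
  incr .k ;;
  forNeighbours .u (
    .write .deg (get .w) (.sub (cell .deg (get .w)) (.lit 1)) ;;
    .ifThen (.eq (cell .deg (get .w)) (.lit 1)) (enqueue .w))

/-- As long as the queue is non-empty, take its first vertex `v`; if `v` is (still) a leaf of the
current graph, process it. -/
def mainLoop : Prog Reg Arr :=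
  .while (.lt (get .front) (get .back)) (
    .set .v (cell .queue (get .front)) ;;
    incr .front ;;
    .ifThen (.and (.eq (cell .vertex (get .v)) (.lit 1)) (.eq (cell .deg (get .v)) (.lit 1)))
      removeLeaf)

/-- The answer is `1` if no vertex is left, and `0` otherwise. -/
def testEmpty : Prog Reg Arr :=
  .set .ans (.lit 1) ;;
  forVertices (
    .ifThen (.eq (cell .vertex (get .i)) (.lit 1)) (.set .ans (.lit 0)))

/-- The leaf-removal algorithm for unique perfect matchings. -/
def uniquePerfectMatching : Prog Reg Arr :=
  initVertices ;;
  initLeaves ;;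
  .set .k (.lit 0) ;;
  mainLoop ;;
  testEmpty

/-! ### Input and output -/

/-- The memory contains the graph `G` in the form of adjacency lists, which may be in any order;
everything else in the memory is arbitrary. -/
def IsInput {n : ℕ} (G : SimpleGraph (Fin n)) (s : Store Reg Arr) : Prop :=
  s.reg .n = n ∧
  s.arr .start 0 = 0 ∧
  ∀ v : Fin n,
    s.arr .start (v : ℕ) ≤ s.arr .start ((v : ℕ) + 1) ∧
    Set.BijOn (s.arr .adj) (Set.Ico (s.arr .start (v : ℕ)) (s.arr .start ((v : ℕ) + 1)))
      (Fin.val '' G.neighborSet v)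

/-- The output lists the edges of `M`, each of them once. -/
def IsOutput {n : ℕ} {G : SimpleGraph (Fin n)} (M : G.Subgraph) (s : Store Reg Arr) : Prop :=
  Set.BijOn (fun i => s(s.arr .fst i, s.arr .snd i)) (Set.Iio (s.reg .k))
    (Sym2.map Fin.val '' M.edgeSet)

end UPM

/-! Correctness rests on two facts. First, a leaf `v` of the current graph must be matched to its
only neighbour `u` by every perfect matching, and the rest of that matching lives on the remaining
vertices. So the removed edges are forced (`IsForced.erase_leaf`), and if no vertex is left they
form the only perfect matching. Second, suppose that the process stops with a nonempty set `S` of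
present vertices, none of degree one in the subgraph induced by `S`, and that a perfect matching `p`
exists. Since `α + μ = n` and `2μ ≤ n`, a maximum independent set `I` has at least `n/2` vertices,
so `p` matches `I` with its complement. Every `x ∈ I ∩ S` has, besides `p x`, a neighbour `p y` in
`S`, with `y ∈ I ∩ S` and `y ≠ x`. The map `x ↦ y` on a finite set has a cycle; rotating `p` along
its cycles gives a second perfect matching (`IsPartnerFun.exists_ne`). Here the König–Egerváry
property acts as a substitute for bipartiteness. The time bound is amortised: the potential has a
constant for each queue entry and a larger one for each present vertex and each position of its
adjacency list. Removing `v` and `u` releases enough to scan their two lists and to pay for the new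
queue entries (`runs_removeLeaf`, `MainInv.runs_mainLoop`). The queue may hold stale entries; the
invariant only asks that no current leaf is missing from it. -/

namespace UPM

/-! ### A program logic for total correctness with step counts. -/

section Logic

variable {R A : Type}

@[simp] theorem Store.setReg_reg [DecidableEq R] (s : Store R A) (r r' : R) (x : ℕ) :
    (s.setReg r x).reg r' = if r' = r then x else s.reg r' :=
  Function.update_apply ..

@[simp] theorem Store.setReg_arr [DecidableEq R] (s : Store R A) (r : R) (x : ℕ) :
    (s.setReg r x).arr = s.arr := rfl

@[simp] theorem Store.setArr_reg [DecidableEq A] (s : Store R A) (a : A) (i x : ℕ) :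
    (s.setArr a i x).reg = s.reg := rfl

@[simp] theorem Store.setArr_arr [DecidableEq A] (s : Store R A) (a a' : A) (i x : ℕ) :
    (s.setArr a i x).arr a' = if a' = a then Function.update (s.arr a) i x else s.arr a' :=
  Function.update_apply ..

theorem Test.cost_pos (b : Test R A) : 0 < b.cost := by
  cases b <;> simp [Test.cost]

variable [DecidableEq R] [DecidableEq A]

/-- `p`, started in `s`, halts after some number `t` of steps in some `s'` with `Q t s'`. -/
def Runs (p : Prog R A) (s : Store R A) (Q : ℕ → Store R A → Prop) : Prop :=
  ∃ t s', Exec p s t s' ∧ Q t s'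

variable {p q : Prog R A} {b : Test R A} {s : Store R A} {Q Q' : ℕ → Store R A → Prop}

theorem Runs.mono (h : Runs p s Q) (hQ : ∀ t s', Q t s' → Q' t s') : Runs p s Q' := by
  obtain ⟨t, s', h, h'⟩ := h
  exact ⟨t, s', h, hQ _ _ h'⟩

theorem Runs.set {r : R} {e : Expr R A} (h : Q (e.cost + 1) (s.setReg r (e.eval s))) :
    Runs (.set r e) s Q :=
  ⟨_, _, .set .., h⟩

theorem Runs.write {a : A} {e f : Expr R A}
    (h : Q (e.cost + f.cost + 1) (s.setArr a (e.eval s) (f.eval s))) :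
    Runs (.write a e f) s Q :=
  ⟨_, _, .write .., h⟩

theorem Runs.seq (h : Runs p s fun t s' => Runs q s' fun t' => Q (t + t')) :
    Runs (.seq p q) s Q := by
  obtain ⟨t, s', h, t', s'', h', h''⟩ := h
  exact ⟨_, _, .seq h h', h''⟩

theorem Runs.ifThen (h : b.holds s → Runs p s fun t => Q (b.cost + t))
    (h' : ¬ b.holds s → Q b.cost s) : Runs (.ifThen b p) s Q := by
  by_cases hb : b.holds s
  · obtain ⟨t, s', h, h''⟩ := h hb
    exact ⟨_, _, .ifTrue hb h, h''⟩
  · exact ⟨_, _, .ifFalse hb, h' hb⟩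

/-- The rule for loops, with an invariant `I` and a potential `Φ` that pays for the steps. -/
theorem Runs.while (I : Store R A → Prop) (Φ : Store R A → ℕ) (hs : I s)
    (h : ∀ s, I s → b.holds s → Runs p s fun t s' => I s' ∧ b.cost + t + Φ s' ≤ Φ s) :
    Runs (.while b p) s fun t s' => I s' ∧ ¬ b.holds s' ∧ t + Φ s' ≤ Φ s + b.cost := by
  induction hk : Φ s using Nat.strong_induction_on generalizing s with
  | _ k ih =>
    by_cases hb : b.holds s
    · obtain ⟨t, s₁, he, hI, hΦ⟩ := h s hs hb
      -- A test costs at least one step, so the potential strictly decreases in each round. The same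
      -- inequality thus yields termination and the time bound.
      have := b.cost_pos
      obtain ⟨t', s₂, he', hI', hb', hΦ'⟩ := ih (Φ s₁) (by omega) hI rfl
      exact ⟨_, _, .whileTrue hb he he', hI', hb', by omega⟩
    · exact ⟨_, _, .whileFalse hb, hs, hb, by omega⟩

end Logic

/-! ### Rules for the two kinds of loop used by the program. -/

theorem runs_forVertices {body : Prog Reg Arr} {s : Store Reg Arr} (n c : ℕ)
    (I : ℕ → Store Reg Arr → Prop) (hn : s.reg .n = n) (h0 : I 0 (s.setReg .i 0))
    (h : ∀ i s, i < n → s.reg .n = n → s.reg .i = i → I i s →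
      Runs body s fun t s' => t ≤ c ∧ s'.reg .n = n ∧ s'.reg .i = i ∧
        I (i + 1) (s'.setReg .i (i + 1))) :
    Runs (forVertices body) s fun t s' => t ≤ (c + 6) * n + 5 ∧ s'.reg .n = n ∧ I n s' := by
  refine .seq <| .set ?_
  -- Test and increment cost 3 steps each, hence the 6 per round; the initial assignment and the
  -- last test account for the 5.
  refine (Runs.while (fun s => s.reg .i ≤ n ∧ s.reg .n = n ∧ I (s.reg .i) s)
    (fun s => (c + 6) * (n - s.reg .i)) ⟨?_, ?_, ?_⟩ ?_).mono ?_
  · simp [Expr.eval]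
  · simpa using hn
  · simpa [Expr.eval] using h0
  · rintro s ⟨-, hn, hI⟩ hb
    have hi : s.reg .i < n := by simpa [Test.holds, Expr.eval, hn] using hb
    refine .seq <| (h _ s hi hn rfl hI).mono ?_
    rintro t s' ⟨ht, hn', hi', hI'⟩
    refine .set ⟨⟨?_, ?_, ?_⟩, ?_⟩
    · simp [Expr.eval, hi']; omega
    · simpa using hn'
    · simpa [Expr.eval, hi'] using hI'
    · simp only [Test.cost, Expr.cost, Store.setReg_reg, Expr.eval, hi', if_true]
      obtain ⟨d, rfl⟩ := Nat.exists_eq_add_of_lt hi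
      rw [show s.reg .i + d + 1 - (s.reg .i + 1) = d by omega,
        show s.reg .i + d + 1 - s.reg .i = d + 1 by omega]
      linarith
  · rintro t s' ⟨⟨hi, hn, hI⟩, hb, ht⟩
    have hi' : s'.reg .i = n := by
      have : n ≤ s'.reg .i := by simpa [Test.holds, Expr.eval, hn] using hb
      omega
    refine ⟨?_, hn, hi' ▸ hI⟩
    simp [Test.cost, Expr.cost, Expr.eval, hi'] at ht ⊢
    omega

/-- Each round costs 5 + 3 + 4 + 3 = 15 steps besides the body (loop test, reading `w`, presence
test, increment); initialisation and the last test cost 3 + 5. The end `b` of the list is read anew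
in every test, so the invariant has to guarantee its value. -/
theorem runs_forNeighbours {r : Reg} {body : Prog Reg Arr} {s : Store Reg Arr} (a b c : ℕ)
    (I : ℕ → Store Reg Arr → Prop) (hab : a ≤ b)
    (ha : s.arr .start (s.reg r) = a)
    (hb : ∀ j s, I j s → s.arr .start (s.reg r + 1) = b)
    (h0 : I a (s.setReg .j a))
    (hskip : ∀ j s, a ≤ j → j < b → s.reg .j = j → I j s → s.arr .vertex (s.arr .adj j) ≠ 1 →
      I (j + 1) ((s.setReg .w (s.arr .adj j)).setReg .j (j + 1)))
    (hbody : ∀ j s, a ≤ j → j < b → s.reg .j = j → I j s → s.arr .vertex (s.arr .adj j) = 1 →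
      Runs body (s.setReg .w (s.arr .adj j)) fun t s' => t ≤ c ∧ s'.reg .j = j ∧
        I (j + 1) (s'.setReg .j (j + 1))) :
    Runs (forNeighbours r body) s fun t s' => t ≤ (c + 15) * (b - a) + 8 ∧ I b s' := by
  refine .seq <| .set ?_
  refine (Runs.while (fun s => a ≤ s.reg .j ∧ s.reg .j ≤ b ∧ I (s.reg .j) s)
    (fun s => (c + 15) * (b - s.reg .j)) ⟨?_, ?_, ?_⟩ ?_).mono ?_
  · simp [Expr.eval, ha]
  · simpa [Expr.eval, ha] using hab
  · simpa [Expr.eval, ha] using h0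
  · rintro s ⟨haj, -, hI⟩ ht
    have hj : s.reg .j < b := by simpa [Test.holds, Expr.eval, hb _ s hI] using ht
    refine .seq <| .set <| .seq <| .ifThen ?_ ?_
    · intro hv
      simp [Test.holds, Expr.eval] at hv
      refine (hbody _ s haj hj rfl hI hv).mono ?_
      rintro t s' ⟨ht, hj', hI'⟩
      refine .set ⟨⟨?_, ?_, ?_⟩, ?_⟩
      · simp [Expr.eval, hj']; omega
      · simp [Expr.eval, hj']; omega
      · simpa [Expr.eval, hj'] using hI'
      · simp only [Test.cost, Expr.cost, Store.setReg_reg, Expr.eval, hj', if_true]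
        obtain ⟨d, rfl⟩ := Nat.exists_eq_add_of_lt hj
        rw [show s.reg .j + d + 1 - (s.reg .j + 1) = d by omega,
          show s.reg .j + d + 1 - s.reg .j = d + 1 by omega]
        linarith
    · intro hv
      simp [Test.holds, Expr.eval] at hv
      have hI' := hskip _ s haj hj rfl hI hv
      refine .set ⟨⟨?_, ?_, ?_⟩, ?_⟩
      · simp [Expr.eval]; omega
      · simp [Expr.eval]; omega
      · simpa [Expr.eval] using hI'
      · simp [Test.cost, Expr.cost, Expr.eval]
        obtain ⟨d, rfl⟩ := Nat.exists_eq_add_of_lt hj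
        rw [show s.reg .j + d + 1 - (s.reg .j + 1) = d by omega,
          show s.reg .j + d + 1 - s.reg .j = d + 1 by omega]
        linarith
  · rintro t s' ⟨⟨-, hj, hI⟩, hbt, ht⟩
    have hj' : s'.reg .j = b := by
      have : b ≤ s'.reg .j := by simpa [Test.holds, Expr.eval, hb _ s' hI] using hbt
      omega
    refine ⟨?_, hj' ▸ hI⟩
    simp [Test.cost, Expr.cost, Expr.eval, hj', ha] at ht ⊢
    omega

/-! ### Perfect matchings, König–Egerváry graphs and forced edges. -/

section Graph

variable {V : Type*} {G : SimpleGraph V}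

/-- `p` maps each vertex to its partner in some perfect matching of `G`. -/
structure IsPartnerFun (G : SimpleGraph V) (p : V → V) : Prop where
  adj : ∀ v, G.Adj v (p v)
  invol : ∀ v, p (p v) = v

theorem IsPartnerFun.exists_subgraph {p : V → V} (hp : IsPartnerFun G p) :
    ∃ M : G.Subgraph, M.IsPerfectMatching ∧ ∀ v w, M.Adj v w ↔ p v = w := by
  refine ⟨{ verts := Set.univ
            Adj := fun v w => p v = w
            adj_sub := ?_
            edge_vert := fun _ => trivial
            symm := ⟨?_⟩ }, ⟨fun v _ => ⟨p v, rfl, fun _ h => Eq.symm (a := p v) h⟩, fun _ => trivial⟩,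
          fun _ _ => Iff.rfl⟩
  · rintro v w rfl
    exact hp.adj v
  · rintro v w rfl
    exact hp.invol v

theorem exists_isPartnerFun {M : G.Subgraph} (hM : M.IsPerfectMatching) :
    ∃ p, IsPartnerFun G p ∧ ∀ v w, M.Adj v w ↔ p v = w := by
  choose p hp hp' using fun v => hM.1 (hM.2 v)
  refine ⟨p, ⟨fun v => (hp v).adj_sub, fun v => (hp' _ _ (hp v).symm).symm⟩, fun v w =>
    ⟨fun h => (hp' _ _ h).symm, ?_⟩⟩
  rintro rfl
  exact hp v

/-- A perfect matching is determined by its partner function, because its vertex set is everything.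
This allows working with involutions instead of subgraphs. -/
theorem hasUniquePerfectMatching_iff :
    HasUniquePerfectMatching G ↔ ∃! p, IsPartnerFun G p := by
  constructor
  · rintro ⟨M, hM, hu⟩
    obtain ⟨p, hp, h⟩ := exists_isPartnerFun hM
    refine ⟨p, hp, fun q hq => funext fun v => ?_⟩
    obtain ⟨N, hN, h'⟩ := hq.exists_subgraph
    have := hu N hN
    subst this
    exact (h' v (p v)).1 ((h v _).2 rfl)
  · rintro ⟨p, hp, hu⟩
    obtain ⟨M, hM, h⟩ := hp.exists_subgraph
    refine ⟨M, hM, fun N hN => ?_⟩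
    obtain ⟨q, hq, h'⟩ := exists_isPartnerFun hN
    have := hu q hq
    subst this
    refine SimpleGraph.Subgraph.ext ?_ ?_
    · rw [hM.2.verts_eq_univ, hN.2.verts_eq_univ]
    · ext v w
      rw [h, h']

/-- Degrees in a matching are at most one, and they sum to twice the number of edges. With the
König–Egerváry equation this makes `G.indepNum` at least half the number of vertices. -/
theorem two_mul_matchingNum_le [Fintype V] (G : SimpleGraph V) :
    2 * matchingNum G ≤ Fintype.card V := by
  classical
  have : matchingNum G ≤ Fintype.card V / 2 := by
    refine csSup_le ⟨0, ⊥, ?_, by simp⟩ ?_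
    · intro v hv
      exact absurd hv (by simp)
    · rintro k ⟨M, hM, rfl⟩
      have h := M.spanningCoe.sum_degrees_eq_twice_card_edges
      have h1 : ∑ v, M.spanningCoe.degree v ≤ ∑ _v : V, 1 := by
        refine Finset.sum_le_sum fun v _ => ?_
        rw [← SimpleGraph.card_neighborFinset_eq_degree, Finset.card_le_one]
        intro a ha b hb
        simp only [SimpleGraph.mem_neighborFinset, SimpleGraph.Subgraph.spanningCoe_adj] at ha hb
        exact (hM (M.edge_vert ha)).unique ha hb
      have h2 : M.edgeSet.ncard = M.spanningCoe.edgeFinset.card := by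
        rw [← SimpleGraph.Subgraph.edgeSet_spanningCoe, ← SimpleGraph.coe_edgeFinset,
          Set.ncard_coe_finset]
      rw [h] at h1
      simp only [Finset.sum_const, Finset.card_univ, smul_eq_mul, mul_one] at h1
      omega
  omega

/-- In a König–Egerváry graph, a perfect matching matches a maximum independent set with its
complement. -/
theorem IsKonigEgervary.exists_isIndepSet [Fintype V] (h : IsKonigEgervary G) {p : V → V}
    (hp : IsPartnerFun G p) : ∃ I : Finset V, G.IsIndepSet I ∧ ∀ v, v ∈ I ↔ p v ∉ I := by
  classical
  obtain ⟨I, hI⟩ := G.exists_isNIndepSet_indepNum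
  have h2 := two_mul_matchingNum_le G
  rw [IsKonigEgervary, Nat.card_eq_fintype_card] at h
  have hinj : Function.Injective p := fun a b hab => by rw [← hp.invol a, hab, hp.invol]
  have hsub : I.image p ⊆ Iᶜ := by
    intro x hx
    obtain ⟨v, hv, rfl⟩ := Finset.mem_image.1 hx
    rw [Finset.mem_compl]
    intro hv'
    exact hI.isIndepSet hv hv' (hp.adj v).ne (hp.adj v)
  -- Counting: `|Iᶜ| = n - α = μ ≤ n - μ = α = |p(I)|`.
  have heq : I.image p = Iᶜ := by
    refine Finset.eq_of_subset_of_card_le hsub ?_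
    rw [Finset.card_image_of_injective _ hinj, Finset.card_compl, hI.card_eq]
    omega
  refine ⟨I, hI.isIndepSet, fun v => ?_⟩
  rw [← Finset.mem_compl, ← heq, hinj.mem_finset_image]

/-- By the pigeonhole principle an orbit repeats, and the point where it does so is periodic. -/
theorem exists_mem_periodicPts {α : Type*} [Finite α] [Nonempty α] (f : α → α) :
    ∃ x, x ∈ Function.periodicPts f := by
  obtain ⟨x⟩ := ‹Nonempty α›
  obtain ⟨a, b, hab, h⟩ := Finite.exists_ne_map_eq_of_infinite fun k => f^[k] x
  wlog hlt : a < b generalizing a b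
  · exact this b a hab.symm h.symm (by omega)
  refine ⟨f^[a] x, b - a, by omega, ?_⟩
  rw [Function.IsPeriodicPt, Function.IsFixedPt, ← Function.iterate_add_apply,
    Nat.sub_add_cancel hlt.le]
  exact h.symm

/-- Suppose that a perfect matching matches an independent set `I` with its complement, and that
it matches the vertices of a nonempty set `S` among themselves. If no vertex is a leaf in the
subgraph induced by `S`, there is another perfect matching. -/
theorem IsPartnerFun.exists_ne [Finite V] {p : V → V} (hp : IsPartnerFun G p) {I S : Set V}
    (hI : G.IsIndepSet I) (hIp : ∀ v, v ∈ I ↔ p v ∉ I) (hS : ∀ v ∈ S, p v ∈ S)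
    (hne : S.Nonempty) (hleaf : ∀ v ∈ S, ∀ u ∈ S, G.Adj v u → ∃ w ∈ S, G.Adj v w ∧ w ≠ u) :
    ∃ q, IsPartnerFun G q ∧ q ≠ p := by
  classical
  -- A second neighbour `w` of `x` in `S` lies outside `I` by independence, so `y = p w` lies in `I
  -- ∩ S`.
  have key : ∀ x : ↥(I ∩ S), ∃ y : ↥(I ∩ S), G.Adj x (p y) ∧ y ≠ x := by
    rintro ⟨x, hxI, hxS⟩
    obtain ⟨w, hwS, hw, hwp⟩ := hleaf x hxS (p x) (hS x hxS) (hp.adj x)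
    have hwI : w ∉ I := fun hwI => hI hxI hwI hw.ne hw
    refine ⟨⟨p w, by_contra fun h => hwI ((hIp w).2 h), hS w hwS⟩, ?_, ?_⟩
    · simpa [hp.invol] using hw
    · intro h
      have := congrArg p (Subtype.ext_iff.1 h)
      simp only [hp.invol] at this
      exact hwp this
  choose f hf hf' using key
  have : Nonempty ↥(I ∩ S) := by
    obtain ⟨x, hx⟩ := hne
    by_cases hxI : x ∈ I
    · exact ⟨⟨x, hxI, hx⟩⟩
    · exact ⟨⟨p x, by_contra fun h => hxI ((hIp x).2 h), hS x hx⟩⟩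
  obtain ⟨c, hc⟩ := exists_mem_periodicPts f
  -- On its periodic points `f` is a permutation; `σ` extends it to all vertices by the identity, so
  -- that all cycles are rotated at once.
  let e : Equiv.Perm ↥(Function.periodicPts f) := (Function.bijOn_periodicPts f).equiv
  let e' : Equiv.Perm ↥(I ∩ S) := Equiv.Perm.ofSubtype e
  let σ : Equiv.Perm V := Equiv.Perm.ofSubtype e'
  have he' : ∀ x, x ∈ Function.periodicPts f → e' x = f x := fun x hx => by
    simp only [e']
    rw [Equiv.Perm.ofSubtype_apply_of_mem _ hx]
    rfl
  have hσI : ∀ v, σ v ∈ I ↔ v ∈ I := by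
    intro v
    by_cases hv : v ∈ I ∩ S
    · simp only [σ]
      rw [Equiv.Perm.ofSubtype_apply_of_mem _ hv]
      exact iff_of_true (e' ⟨v, hv⟩).2.1 hv.1
    · simp only [σ]
      rw [Equiv.Perm.ofSubtype_apply_of_not_mem _ hv]
  have hσI' : ∀ v, σ.symm v ∈ I ↔ v ∈ I := fun v => by
    rw [← hσI (σ.symm v), σ.apply_symm_apply]
  have hσ : ∀ v ∈ I, G.Adj v (p (σ v)) := by
    intro v hv
    by_cases hvS : v ∈ I ∩ S
    · simp only [σ]
      rw [Equiv.Perm.ofSubtype_apply_of_mem _ hvS]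
      by_cases hvp : (⟨v, hvS⟩ : ↥(I ∩ S)) ∈ Function.periodicPts f
      · rw [he' _ hvp]
        exact hf ⟨v, hvS⟩
      · simp only [e']
        rw [Equiv.Perm.ofSubtype_apply_of_not_mem _ hvp]
        exact hp.adj v
    · simp only [σ]
      rw [Equiv.Perm.ofSubtype_apply_of_not_mem _ hvS]
      exact hp.adj v
  have hpI : ∀ v, v ∉ I → p v ∈ I := fun v hv => by_contra fun h => hv ((hIp v).2 h)
  -- On `I` the new partner is `p ∘ σ`; outside `I` it has to be the inverse map, `σ⁻¹ ∘ p`. They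
  -- fit together because `σ` preserves `I` and `p` exchanges `I` with its complement.
  refine ⟨fun v => if v ∈ I then p (σ v) else σ.symm (p v), ⟨fun v => ?_, fun v => ?_⟩, ?_⟩
  · by_cases hv : v ∈ I
    · simpa [hv] using hσ v hv
    · have := hσ _ ((hσI' _).2 (hpI v hv))
      simp only [σ.apply_symm_apply, hp.invol] at this
      simpa [hv] using this.symm
  · by_cases hv : v ∈ I
    · have : p (σ v) ∉ I := (hIp _).1 ((hσI v).2 hv)
      simp [hv, this, hp.invol]
    · have : σ.symm (p v) ∈ I := (hσI' _).2 (hpI v hv)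
      simp [hv, this, hp.invol]
  · intro h
    have h1 := congrFun h c
    simp only [c.2.1, if_true] at h1
    have h2 := congrArg p h1
    simp only [hp.invol] at h2
    have h3 : σ c = f c := by
      simp only [σ]
      rw [Equiv.Perm.ofSubtype_apply_of_mem _ c.2]
      rw [he' _ hc]
    exact hf' c (Subtype.ext (h3.symm.trans h2))

/-- The edges joining `fst i` and `snd i`, for `i < k`, are pairwise distinct, they form a perfect
matching `q` of the subgraph induced by the complement of `S`, and every perfect matching contains
them. -/
structure IsForced {n : ℕ} (G : SimpleGraph (Fin n)) (S : Finset (Fin n)) (q : Fin n → Fin n)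
    (k : ℕ) (fst snd : ℕ → ℕ) : Prop where
  adj : ∀ v, v ∉ S → G.Adj v (q v)
  notMem : ∀ v, v ∉ S → q v ∉ S
  invol : ∀ v, v ∉ S → q (q v) = v
  forced : ∀ p, IsPartnerFun G p → ∀ v, v ∉ S → p v = q v
  bijOn : Set.BijOn (fun i => s(fst i, snd i)) (Set.Iio k)
    ((fun v : Fin n => s((v : ℕ), (q v : ℕ))) '' {v | v ∉ S})

variable {n : ℕ} {G : SimpleGraph (Fin n)} {S : Finset (Fin n)} {q : Fin n → Fin n}
  {k : ℕ} {fst snd : ℕ → ℕ}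

theorem isForced_univ : IsForced G Finset.univ q 0 fst snd := by
  constructor <;> simp

/-- Outside `S` the matching `p` agrees with `q`, which preserves the complement of `S`; as `p` is
an involution, it preserves `S` too. -/
theorem IsForced.partner_mem (h : IsForced G S q k fst snd) {p : Fin n → Fin n}
    (hp : IsPartnerFun G p) {v : Fin n} (hv : v ∈ S) : p v ∈ S := by
  by_contra hpv
  have h1 := h.forced p hp _ hpv
  rw [hp.invol] at h1
  exact h.notMem _ hpv (h1 ▸ hv)

/-- Removing a leaf `v` of the current graph, together with its neighbour `u`. -/
theorem IsForced.erase_leaf (h : IsForced G S q k fst snd) {v u : Fin n} (hv : v ∈ S)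
    (hu : u ∈ S) (hvu : G.Adj v u) (hleaf : ∀ w ∈ S, G.Adj v w → w = u) :
    IsForced G ((S.erase v).erase u) (Function.update (Function.update q v u) u v) (k + 1)
      (Function.update fst k v) (Function.update snd k u) := by
  have hne := hvu.ne
  have hmem : ∀ x, x ∉ (S.erase v).erase u ↔ x = u ∨ x = v ∨ x ∉ S := by
    intro x; simp only [Finset.mem_erase]; tauto
  have hqu : Function.update (Function.update q v u) u v u = v := by simp
  have hqv : Function.update (Function.update q v u) u v v = u := by simp [hne]
  have hqx : ∀ x, x ∉ S → Function.update (Function.update q v u) u v x = q x := by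
    intro x hx
    have h1 : x ≠ u := by rintro rfl; exact hx hu
    have h2 : x ≠ v := by rintro rfl; exact hx hv
    simp [h1, h2]
  -- Only the values at `u`, at `v` and outside `S` matter from here on.
  generalize Function.update (Function.update q v u) u v = q' at *
  refine ⟨?_, ?_, ?_, ?_, ?_⟩
  · intro x hx
    rcases (hmem x).1 hx with rfl | rfl | hx
    · rw [hqu]; exact hvu.symm
    · rw [hqv]; exact hvu
    · rw [hqx x hx]; exact h.adj x hx
  · intro x hx
    rw [hmem]
    rcases (hmem x).1 hx with rfl | rfl | hx
    · simp [hqu]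
    · simp [hqv]
    · simp [hqx x hx, h.notMem x hx]
  · intro x hx
    rcases (hmem x).1 hx with rfl | rfl | hx
    · rw [hqu, hqv]
    · rw [hqv, hqu]
    · rw [hqx x hx, hqx _ (h.notMem x hx), h.invol x hx]
  · intro p hp x hx
    have hpv : p v = u := hleaf _ (h.partner_mem hp hv) (hp.adj v)
    rcases (hmem x).1 hx with rfl | rfl | hx
    · rw [hqu, ← hpv, hp.invol]
    · rw [hqv, hpv]
    · rw [hqx x hx, h.forced p hp x hx]
  · have himage : (fun x : Fin n => s((x : ℕ), (q' x : ℕ))) '' {x | x ∉ (S.erase v).erase u} =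
        insert s((v : ℕ), (u : ℕ)) ((fun x : Fin n => s((x : ℕ), (q x : ℕ))) '' {x | x ∉ S}) := by
      ext e
      constructor
      · rintro ⟨x, hx, rfl⟩
        rcases (hmem x).1 hx with rfl | rfl | hx
        · left; simp [hqu, Sym2.eq_swap]
        · left; simp [hqv]
        · right; exact ⟨x, hx, by simp [hqx x hx]⟩
      · rintro (rfl | ⟨x, hx, rfl⟩)
        · exact ⟨v, (hmem v).2 (by simp), by simp [hqv]⟩
        · exact ⟨x, (hmem x).2 (by simp [show x ∉ S from hx]), by simp [hqx x hx]⟩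
    rw [himage, ← Order.succ_eq_add_one, Order.Iio_succ_eq_insert]
    have hval : s(Function.update fst k (v : ℕ) k, Function.update snd k (u : ℕ) k) =
      s((v : ℕ), (u : ℕ)) := by simp
    rw [← hval]
    refine Set.BijOn.insert (h.bijOn.congr ?_) ?_
    · intro i hi
      have : i ≠ k := (Set.mem_Iio.1 hi).ne
      simp [this]
    -- The new edge is not an old one: an old edge has an end outside `S`, whereas `v` and `u`
    -- belong to `S`.
    · rw [hval]
      rintro ⟨x, hx, hxe⟩
      simp only [Sym2.eq_iff, Fin.val_inj] at hxe
      rcases hxe with ⟨rfl, -⟩ | ⟨rfl, -⟩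
      · exact hx hv
      · exact hx hu

theorem IsForced.isPartnerFun (h : IsForced G ∅ q k fst snd) : IsPartnerFun G q :=
  ⟨fun v => h.adj v (by simp), fun v => h.invol v (by simp)⟩

/-- Vertices isolated in `S` are allowed by `hleaf`: a perfect matching would give them a partner in
`S`, so they need no separate treatment. -/
theorem IsForced.hasUniquePerfectMatching_iff (h : IsForced G S q k fst snd)
    (hG : IsKonigEgervary G)
    (hleaf : ∀ v ∈ S, ∀ u ∈ S, G.Adj v u → ∃ w ∈ S, G.Adj v w ∧ w ≠ u) :
    HasUniquePerfectMatching G ↔ S = ∅ := by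
  rw [UPM.hasUniquePerfectMatching_iff]
  constructor
  · rintro ⟨p, hp, hu⟩
    by_contra hS
    obtain ⟨I, hI, hIp⟩ := hG.exists_isIndepSet hp
    obtain ⟨r, hr, hrp⟩ := hp.exists_ne (I := I) (S := S) hI (by simpa using hIp)
      (fun v hv => h.partner_mem hp hv) (by simpa [Finset.nonempty_iff_ne_empty] using hS)
      (by simpa using hleaf)
    exact hrp (hu r hr)
  · rintro rfl
    exact ⟨q, h.isPartnerFun, fun p hp => funext fun v => h.forced p hp v (by simp)⟩

theorem IsForced.isOutput {s : Store Reg Arr}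
    (h : IsForced G ∅ q (s.reg .k) (s.arr .fst) (s.arr .snd)) {M : G.Subgraph}
    (hM : M.IsPerfectMatching) : IsOutput M s := by
  have : Sym2.map Fin.val '' M.edgeSet =
      (fun v : Fin n => s((v : ℕ), (q v : ℕ))) '' {v | v ∉ (∅ : Finset (Fin n))} := by
    obtain ⟨p, hp, hpM⟩ := exists_isPartnerFun hM
    have hpq : p = q := funext fun v => h.forced p hp v (by simp)
    subst hpq
    ext e
    constructor
    · rintro ⟨e, he, rfl⟩
      induction e with
      | _ v w =>
        refine ⟨v, by simp, ?_⟩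
        rw [SimpleGraph.Subgraph.mem_edgeSet, hpM] at he
        simp [he]
    · rintro ⟨v, -, rfl⟩
      exact ⟨s(v, p v), (hpM _ _).2 rfl, rfl⟩
  rw [IsOutput, this]
  exact h.bijOn

end Graph

/-! ### Adjacency lists and degrees in the current graph. -/

variable {n : ℕ} {G : SimpleGraph (Fin n)} {start nbr : ℕ → ℕ} {S : Finset (Fin n)}
  {d : Fin n → ℕ} {s : Store Reg Arr}

open Classical in
/-- The number of neighbours of `v` in `S`. -/
noncomputable def degIn (G : SimpleGraph (Fin n)) (S : Finset (Fin n)) (v : Fin n) : ℕ :=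
  (S.filter (G.Adj v)).card

/-- The arrays `start` and `nbr` contain the adjacency lists of `G`. -/
def IsAdjLists (G : SimpleGraph (Fin n)) (start nbr : ℕ → ℕ) : Prop :=
  ∀ v : Fin n, start v ≤ start (v + 1) ∧
    Set.BijOn nbr (Set.Ico (start v) (start (v + 1))) (Fin.val '' G.neighborSet v)

theorem IsAdjLists.length_eq (h : IsAdjLists G start nbr) (v : Fin n) :
    start (v + 1) - start v = degIn G Finset.univ v := by
  classical
  have h1 := (h v).2.ncard_eq
  rw [Set.ncard_image_of_injective _ Fin.val_injective, ← Finset.coe_Ico, Set.ncard_coe_finset,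
    Nat.card_Ico] at h1
  rw [h1, degIn, ← Set.ncard_coe_finset]
  congr 1
  ext w
  simp

theorem sum_degIn_univ (G : SimpleGraph (Fin n)) :
    ∑ v, degIn G Finset.univ v = 2 * G.edgeSet.ncard := by
  classical
  rw [← SimpleGraph.coe_edgeFinset, Set.ncard_coe_finset, ← G.sum_degrees_eq_twice_card_edges]
  refine Finset.sum_congr rfl fun v _ => ?_
  rw [degIn, ← G.card_neighborFinset_eq_degree]
  congr 1
  ext w
  simp

theorem degIn_eq_one {v : Fin n} (h : degIn G S v = 1) :
    ∃ u ∈ S, G.Adj v u ∧ ∀ w ∈ S, G.Adj v w → w = u := by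
  classical
  obtain ⟨u, hu⟩ := Finset.card_eq_one.1 h
  have h1 : ∀ w, w ∈ S ∧ G.Adj v w ↔ w = u := fun w => by
    rw [← Finset.mem_filter, hu, Finset.mem_singleton]
  exact ⟨u, ((h1 u).2 rfl).1, ((h1 u).2 rfl).2, fun w hw hvw => (h1 w).1 ⟨hw, hvw⟩⟩

theorem exists_adj_ne_of_degIn_ne_one {v u : Fin n} (h : degIn G S v ≠ 1) (hu : u ∈ S)
    (hvu : G.Adj v u) : ∃ w ∈ S, G.Adj v w ∧ w ≠ u := by
  classical
  by_contra! hw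
  refine h (Finset.card_eq_one.2 ⟨u, ?_⟩)
  ext w
  rw [Finset.mem_filter, Finset.mem_singleton]
  refine ⟨fun h => hw w h.1 h.2, ?_⟩
  rintro rfl
  exact ⟨hu, hvu⟩

-- A remaining vertex `x` loses only `u`: it is not adjacent to `v`, since `u` is the only neighbour
-- of `v` in `S` and `x ≠ u`.
open Classical in
theorem degIn_erase_leaf {v u : Fin n} (hu : u ∈ S)
    (hleaf : ∀ w ∈ S, G.Adj v w → w = u) {x : Fin n} (hx : x ∈ (S.erase v).erase u) :
    degIn G ((S.erase v).erase u) x = degIn G S x - if G.Adj u x then 1 else 0 := by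
  simp only [Finset.mem_erase] at hx
  have h1 : ((S.erase v).erase u).filter (G.Adj x) = (S.filter (G.Adj x)).erase u := by
    ext w
    simp only [Finset.mem_filter, Finset.mem_erase]
    refine ⟨by tauto, fun ⟨h1, h2, h3⟩ => ⟨⟨h1, ?_, h2⟩, h3⟩⟩
    rintro rfl
    exact hx.1 (hleaf x hx.2.2 h3.symm)
  rw [degIn, degIn, h1, Finset.card_erase_eq_ite]
  by_cases h : G.Adj u x
  · simp [hu, h, h.symm]
  · simp [h, show ¬ G.Adj x u from fun h' => h h'.symm]

/-! ### Invariants for the degree array and the queue. -/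

/-- The array `deg` agrees with `d` on `S`, and all `v ∈ S` with `d v = 1` are in the queue. -/
structure QueueInv (start nbr : ℕ → ℕ) (S : Finset (Fin n)) (d : Fin n → ℕ)
    (s : Store Reg Arr) : Prop where
  n_eq : s.reg .n = n
  start_eq : s.arr .start = start
  adj_eq : s.arr .adj = nbr
  deg_eq : ∀ v ∈ S, s.arr .deg v = d v
  front_le : s.reg .front ≤ s.reg .back
  queue_lt : ∀ i < s.reg .back, s.arr .queue i < n
  leaf : ∀ v ∈ S, d v = 1 → ∃ i, s.reg .front ≤ i ∧ i < s.reg .back ∧ s.arr .queue i = v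

theorem QueueInv.of_eq {s' : Store Reg Arr} (h : QueueInv start nbr S d s)
    (hn : s'.reg .n = s.reg .n) (hf : s'.reg .front = s.reg .front)
    (hb : s'.reg .back = s.reg .back) (hs : s'.arr .start = s.arr .start)
    (ha : s'.arr .adj = s.arr .adj) (hd : s'.arr .deg = s.arr .deg)
    (hq : s'.arr .queue = s.arr .queue) : QueueInv start nbr S d s' := by
  obtain ⟨h1, h2, h3, h4, h5, h6, h7⟩ := h
  constructor <;> simp only [hn, hf, hb, hs, ha, hd, hq] <;> assumption

/-- Keeping `S` and `d` as independent parameters lets the invariant hold while the degree array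
lags behind the current graph. -/
theorem QueueInv.mono {T : Finset (Fin n)} {d' : Fin n → ℕ} (h : QueueInv start nbr S d s)
    (hT : T ⊆ S) (hd : ∀ v ∈ T, d' v = d v) : QueueInv start nbr T d' s :=
  { h with
    deg_eq := fun v hv => by rw [hd v hv, h.deg_eq v (hT hv)]
    leaf := fun v hv h1 => h.leaf v (hT hv) (by rw [← hd v hv, h1]) }

/-- Set the degree of the vertex in register `r`, and enqueue this vertex if it is a leaf. -/
theorem QueueInv.runs_setDeg (h : QueueInv start nbr S d s) {r : Reg}
    {x : Fin n} (hx : s.reg r = x) (e : Expr Reg Arr) :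
    Runs (.write .deg (get r) e ;; .ifThen (.eq (cell .deg (get r)) (.lit 1)) (enqueue r)) s
      fun t s' => t ≤ e.cost + 12 ∧
        QueueInv start nbr (insert x S) (Function.update d x (e.eval s)) s' ∧
        (∀ r', r' ≠ .back → s'.reg r' = s.reg r') ∧ s'.reg .back ≤ s.reg .back + 1 ∧
        ∀ a, a ≠ .deg → a ≠ .queue → s'.arr a = s.arr a := by
  have hdeg : ∀ v ∈ insert x S,
      Function.update (s.arr .deg) x (e.eval s) v = Function.update d x (e.eval s) v := by
    intro v hv
    by_cases hvx : v = x
    · simp [hvx]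
    · have : (v : ℕ) ≠ x := fun h => hvx (Fin.ext h)
      simp only [Finset.mem_insert, hvx, false_or] at hv
      simp [hvx, this, h.deg_eq v hv]
  have hle := h.front_le
  refine .seq <| .write <| .ifThen ?_ ?_
  · intro _
    refine .seq <| .write <| .set ⟨?_, ⟨?_, ?_, ?_, ?_, ?_, ?_, ?_⟩, ?_, ?_, ?_⟩
    · simp [Expr.cost, Test.cost]; omega
    · simpa using h.n_eq
    · simpa using h.start_eq
    · simpa using h.adj_eq
    · simpa [Expr.eval, hx] using hdeg
    · simp [Expr.eval]; omega
    · intro i hi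
      simp only [Store.setReg_reg, Store.setReg_arr, Store.setArr_reg, Store.setArr_arr,
        Expr.eval, if_true] at hi ⊢
      by_cases hib : i = s.reg .back
      · simp [hib, hx]
      · simpa [hib] using h.queue_lt i (by omega)
    · intro v hv hv1
      simp only [Store.setReg_reg, Store.setReg_arr, Store.setArr_reg, Store.setArr_arr,
        Expr.eval, if_true, reduceCtorEq, if_false]
      by_cases hvx : v = x
      · exact ⟨s.reg .back, hle, by omega, by simp [hx, hvx]⟩
      · simp only [Finset.mem_insert, hvx, false_or] at hv
        obtain ⟨i, hi, hi', hi''⟩ := h.leaf v hv (by simpa [hvx] using hv1)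
        exact ⟨i, hi, by omega, by simp [hi'.ne, hi'']⟩
    · intro r' hr'
      simp [hr']
    · simp [Expr.eval]
    · intro a ha ha'
      simp [ha, ha']
  · intro ht
    simp only [Test.holds, Expr.eval, Store.setArr_arr, Store.setArr_reg, if_true, hx,
      Function.update_self] at ht
    refine ⟨?_, ⟨?_, ?_, ?_, ?_, ?_, ?_, ?_⟩, ?_, ?_, ?_⟩
    · simp [Expr.cost, Test.cost]; omega
    · simpa using h.n_eq
    · simpa using h.start_eq
    · simpa using h.adj_eq
    · simpa [Expr.eval, hx] using hdeg
    · simpa using hle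
    · simpa using h.queue_lt
    · intro v hv hv1
      by_cases hvx : v = x
      · subst hvx
        exact absurd (by simpa using hv1) ht
      · simp only [Finset.mem_insert, hvx, false_or] at hv
        simpa using h.leaf v hv (by simpa [hvx] using hv1)
    · intro r' hr'
      simp
    · simp
    · intro a ha ha'
      simp [ha]

/-- The invariant of the main loop, where `S` is the vertex set of the current graph. -/
structure MainInv (G : SimpleGraph (Fin n)) (start nbr : ℕ → ℕ) (S : Finset (Fin n))
    (s : Store Reg Arr) : Prop where
  queue : QueueInv start nbr S (degIn G S) s
  vertex : ∀ v : Fin n, s.arr .vertex v = if v ∈ S then 1 else 0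
  forced : ∃ q, IsForced G S q (s.reg .k) (s.arr .fst) (s.arr .snd)

/-! ### The phases of the program outside the main loop, and the two scans within a removal. -/

theorem runs_initVertices (hn : s.reg .n = n) :
    Runs initVertices s fun t s' => t ≤ 9 * n + 5 ∧ s'.reg .n = n ∧
      s'.arr .start = s.arr .start ∧ s'.arr .adj = s.arr .adj ∧
      ∀ v : Fin n, s'.arr .vertex v = 1 := by
  refine (runs_forVertices n 3 (fun i s' => s'.arr .start = s.arr .start ∧
    s'.arr .adj = s.arr .adj ∧ ∀ v < i, s'.arr .vertex v = 1) hn (by simp) ?_).mono ?_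
  · rintro i s' hi hn' hi' ⟨h1, h2, h3⟩
    refine .write ⟨by simp [Expr.cost], by simpa using hn', by simpa using hi', by simpa using h1,
      by simpa using h2, fun v hv => ?_⟩
    by_cases hvi : v = i
    · simp [Expr.eval, hi', hvi]
    · simpa [Expr.eval, hi', hvi] using h3 v (by omega)
  · rintro t s' ⟨ht, hn', h1, h2, h3⟩
    exact ⟨ht, hn', h1, h2, fun v => h3 v v.2⟩

theorem runs_initLeaves (hn : s.reg .n = n) (hs : s.arr .start = start) (ha : s.arr .adj = nbr)
    (hv : ∀ v : Fin n, s.arr .vertex v = 1) :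
    Runs initLeaves s fun t s' => t ≤ 24 * n + 9 ∧
      QueueInv start nbr Finset.univ (fun v : Fin n => start (v + 1) - start v) s' ∧
      s'.reg .front = 0 ∧ s'.reg .back ≤ n ∧ ∀ v : Fin n, s'.arr .vertex v = 1 := by
  -- The queue invariant is built up on the initial segment of vertices below `i`; each round
  -- inserts the vertex `i`.
  refine .seq <| .set <| .seq <| .set <| (runs_forVertices n 18 (fun i s' =>
    QueueInv start nbr (Finset.univ.filter fun v : Fin n => (v : ℕ) < i)
      (fun v : Fin n => start (v + 1) - start v) s' ∧
      s'.reg .front = 0 ∧ s'.reg .back ≤ i ∧ ∀ v : Fin n, s'.arr .vertex v = 1)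
    (by simpa using hn) ⟨?_, ?_, ?_, ?_⟩ ?_).mono ?_
  · constructor <;> simp [Expr.eval, hn, hs, ha]
  · simp [Expr.eval]
  · simp [Expr.eval]
  · simpa using hv
  · rintro i s' hi hn' hi' ⟨h1, h2, h3, h4⟩
    refine (h1.runs_setDeg (r := .i) (x := ⟨i, hi⟩) hi' _).mono ?_
    rintro t s'' ⟨ht, hQ, hreg, hback, harr⟩
    refine ⟨by simpa [Expr.cost] using ht, by rw [hreg _ (by simp), hn'],
      by rw [hreg _ (by simp), hi'], ?_, ?_, ?_, ?_⟩
    · refine (hQ.mono ?_ ?_).of_eq ?_ ?_ ?_ rfl rfl rfl rfl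
      · intro v hv
        simp only [Finset.mem_filter, Finset.mem_univ, true_and, Finset.mem_insert,
          Fin.ext_iff] at hv ⊢
        omega
      · intro v hv
        by_cases hvi : v = ⟨i, hi⟩
        · simp [hvi, Expr.eval, hi', h1.start_eq]
        · simp [hvi]
      all_goals simp
    · simpa [hreg] using h2
    · simp; omega
    · simpa [harr] using h4
  · rintro t s' ⟨ht, hn', h1, h2, h3, h4⟩
    refine ⟨by simp [Expr.cost]; omega, h1.mono ?_ fun _ _ => rfl, h2, h3, h4⟩
    intro v _
    simp

theorem runs_testEmpty (hn : s.reg .n = n)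
    (hv : ∀ v : Fin n, s.arr .vertex v = if v ∈ S then 1 else 0) :
    Runs testEmpty s fun t s' => t ≤ 12 * n + 7 ∧ s'.arr = s.arr ∧ s'.reg .k = s.reg .k ∧
      (S = ∅ → s'.reg .ans = 1) ∧ (S ≠ ∅ → s'.reg .ans = 0) := by
  refine .seq <| .set <| (runs_forVertices n 6 (fun i s' => s'.arr = s.arr ∧
    s'.reg .k = s.reg .k ∧ ((∀ v ∈ S, i ≤ v) → s'.reg .ans = 1) ∧
    ((∃ v ∈ S, v < i) → s'.reg .ans = 0)) (by simpa using hn) (by simp [Expr.eval]) ?_).mono ?_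
  · rintro i s' hi hn' hi' ⟨h1, h2, h3, h4⟩
    have hvi := hv ⟨i, hi⟩
    simp only at hvi
    refine .ifThen ?_ ?_
    · intro ht
      have hiS : ⟨i, hi⟩ ∈ S := by
        simpa [Test.holds, Expr.eval, hi', h1, hvi] using ht
      refine .set ⟨by simp [Test.cost, Expr.cost], by simpa using hn', by simpa using hi',
        by simpa using h1, by simpa using h2, fun h => ?_, fun _ => by simp [Expr.eval]⟩
      have := h _ hiS
      simp at this
    · intro ht
      have hiS : ⟨i, hi⟩ ∉ S := by
        simpa [Test.holds, Expr.eval, hi', h1, hvi] using ht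
      refine ⟨by simp [Test.cost, Expr.cost], hn', hi', by simpa using h1, by simpa using h2,
        fun h => ?_, ?_⟩
      · simpa using h3 fun v hv => (Nat.le_succ i).trans (h v hv)
      · rintro ⟨v, hv, hvi⟩
        have : (v : ℕ) ≠ i := fun h => hiS (by rwa [show (⟨i, hi⟩ : Fin n) = v from Fin.ext h.symm])
        simpa using h4 ⟨v, hv, by omega⟩
  · rintro t s' ⟨ht, -, h1, h2, h3, h4⟩
    refine ⟨by simp [Expr.cost]; omega, h1, h2, ?_, fun hS => ?_⟩
    · rintro rfl
      exact h3 (by simp)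
    · obtain ⟨v, hv⟩ := Finset.nonempty_iff_ne_empty.2 hS
      exact h4 ⟨v, hv, v.2⟩

/-- The first part of `removeLeaf` finds the neighbour of a leaf. -/
theorem runs_findNeighbour (hG : IsAdjLists G start nbr) (hs : s.arr .start = start)
    (ha : s.arr .adj = nbr) (hvert : ∀ v : Fin n, s.arr .vertex v = if v ∈ S then 1 else 0)
    {v u : Fin n} (hv : s.reg .v = v) (hu : u ∈ S) (hvu : G.Adj v u)
    (hleaf : ∀ w ∈ S, G.Adj v w → w = u) :
    Runs (forNeighbours .v (.set .u (get .w))) s fun t s' =>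
      t ≤ 17 * (start (v + 1) - start v) + 8 ∧ s'.arr = s.arr ∧ s'.reg .u = u ∧
      ∀ r, r ≠ .u → r ≠ .w → r ≠ .j → s'.reg r = s.reg r := by
  have hnbr : ∀ j, start v ≤ j → j < start (v + 1) → ∃ x : Fin n, G.Adj v x ∧ nbr j = x := by
    intro j hj hj'
    obtain ⟨x, hx, hx'⟩ := (hG v).2.mapsTo ⟨hj, hj'⟩
    exact ⟨x, hx, hx'.symm⟩
  -- Once the position of `u` has been passed, the register stays correct, because `u` is the only
  -- present vertex in the list of `v`.
  refine (runs_forNeighbours (start v) (start (v + 1)) 2 (fun j s' => s'.arr = s.arr ∧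
    ((∃ i, start v ≤ i ∧ i < j ∧ nbr i = u) → s'.reg .u = u) ∧
    ∀ r, r ≠ .u → r ≠ .w → r ≠ .j → s'.reg r = s.reg r) (hG v).1 (by rw [hs, hv])
    ?_ ⟨?_, ?_, ?_⟩ ?_ ?_).mono ?_
  · rintro j s' ⟨h1, -, h2⟩
    rw [h1, h2 _ (by simp) (by simp) (by simp), hv, hs]
  · simp
  · rintro ⟨i, h1, h2, -⟩
    omega
  · intro r _ _ hr
    simp [hr]
  · rintro j s' hj hj' - ⟨h1, h2, h3⟩ hne
    refine ⟨by simpa using h1, ?_, fun r hr hr' hr'' => by simp [hr', hr'', h3 r hr hr' hr'']⟩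
    rintro ⟨i, hi, hij, hiu⟩
    have : i ≠ j := by
      rintro rfl
      rw [h1, ha, hiu, hvert, if_pos hu] at hne
      exact hne rfl
    simpa using h2 ⟨i, hi, by omega, hiu⟩
  · rintro j s' hj hj' hjs ⟨h1, h2, h3⟩ heq
    obtain ⟨x, hx, hx'⟩ := hnbr j hj hj'
    rw [h1, ha, hx', hvert] at heq
    have hxS : x ∈ S := by
      by_contra hxS
      simp [hxS] at heq
    obtain rfl := hleaf x hxS hx
    refine .set ⟨by simp [Expr.cost], by simpa using hjs, by simpa using h1, fun _ => ?_,
      fun r hr hr' hr'' => by simp [hr, hr', hr'', h3 r hr hr' hr'']⟩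
    simp [Expr.eval, h1, ha, hx']
  · rintro t s' ⟨ht, h1, h2, h3⟩
    obtain ⟨i, hi, hi'⟩ := (hG v).2.surjOn ⟨u, hvu, rfl⟩
    exact ⟨ht, h1, h2 ⟨i, hi.1, hi.2, hi'⟩, h3⟩

open Classical in
/-- The last part of `removeLeaf` updates the degrees of the neighbours of the vertex `u`. -/
theorem QueueInv.runs_decrement (hG : IsAdjLists G start nbr) (h : QueueInv start nbr S d s)
    (hvert : ∀ v : Fin n, s.arr .vertex v = if v ∈ S then 1 else 0) {u : Fin n}
    (hu : s.reg .u = u) :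
    Runs (forNeighbours .u (
        .write .deg (get .w) (.sub (cell .deg (get .w)) (.lit 1)) ;;
        .ifThen (.eq (cell .deg (get .w)) (.lit 1)) (enqueue .w))) s fun t s' =>
      t ≤ 31 * (start (u + 1) - start u) + 8 ∧
      QueueInv start nbr S (fun x => d x - if G.Adj u x then 1 else 0) s' ∧
      s'.reg .front = s.reg .front ∧ s'.reg .k = s.reg .k ∧
      s'.reg .back ≤ s.reg .back + (start (u + 1) - start u) ∧
      s'.arr .vertex = s.arr .vertex ∧ s'.arr .fst = s.arr .fst ∧ s'.arr .snd = s.arr .snd := by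
  have hnbr : ∀ j, start u ≤ j → j < start (u + 1) → ∃ x : Fin n, G.Adj u x ∧ nbr j = x := by
    intro j hj hj'
    obtain ⟨x, hx, hx'⟩ := (hG u).2.mapsTo ⟨hj, hj'⟩
    exact ⟨x, hx, hx'.symm⟩
  have hstep : ∀ j (x y : Fin n), nbr j = x → start u ≤ j →
      ((∃ i, start u ≤ i ∧ i < j + 1 ∧ nbr i = y) ↔
        y = x ∨ ∃ i, start u ≤ i ∧ i < j ∧ nbr i = y) := by
    intro j x y hx hj
    constructor
    · rintro ⟨i, hi, hij, hiy⟩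
      by_cases hij' : i = j
      · left
        rw [hij', hx] at hiy
        exact (Fin.ext hiy).symm
      · exact .inr ⟨i, hi, by omega, hiy⟩
    · rintro (rfl | ⟨i, hi, hij, hiy⟩)
      · exact ⟨j, hj, by omega, hx⟩
      · exact ⟨i, hi, by omega, hiy⟩
  -- At position `j` the degrees are already corrected for exactly those neighbours that occur
  -- before `j`.
  refine (runs_forNeighbours (start u) (start (u + 1)) 16 (fun j s' =>
    QueueInv start nbr S
      (fun x => d x - if ∃ i, start u ≤ i ∧ i < j ∧ nbr i = x then 1 else 0) s' ∧
    s'.reg .u = u ∧ s'.reg .front = s.reg .front ∧ s'.reg .k = s.reg .k ∧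
    s'.reg .back ≤ s.reg .back + (j - start u) ∧ s'.arr .vertex = s.arr .vertex ∧
    s'.arr .fst = s.arr .fst ∧ s'.arr .snd = s.arr .snd)
    (hG u).1 (by rw [h.start_eq, hu]) ?_ ?_ ?_ ?_).mono ?_
  · rintro j s' ⟨h1, h2, -⟩
    rw [h1.start_eq, h2]
  · refine ⟨(h.mono subset_rfl fun x _ => ?_).of_eq ?_ ?_ ?_ rfl rfl rfl rfl, ?_⟩
    · rw [if_neg, Nat.sub_zero]
      rintro ⟨i, h1, h2, -⟩
      omega
    all_goals simp [hu]
  · rintro j s' hj hj' - ⟨h1, h2, h3, h4, h5, h6, h7⟩ hne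
    obtain ⟨x, hx, hx'⟩ := hnbr j hj hj'
    refine ⟨(h1.mono subset_rfl fun y hy => ?_).of_eq ?_ ?_ ?_ rfl rfl rfl rfl, ?_⟩
    · rw [h1.adj_eq, hx', h6, hvert] at hne
      have : y ≠ x := by
        rintro rfl
        exact hne (if_pos hy)
      simp only [hstep j x y hx' hj, this, false_or]
    iterate 3 simp
    · simp [h2, h3, h4, h6, h7]
      omega
  · rintro j s' hj hj' hjs ⟨h1, h2, h3, h4, h5, h6, h7⟩ heq
    obtain ⟨x, hx, hx'⟩ := hnbr j hj hj'
    have hxS : x ∈ S := by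
      rw [h1.adj_eq, hx', h6, hvert] at heq
      by_contra hxS
      simp [hxS] at heq
    -- The list has no repetitions, so no degree is decremented twice.
    have hnew : ¬ ∃ i, start u ≤ i ∧ i < j ∧ nbr i = x := by
      rintro ⟨i, hi, hij, hix⟩
      exact hij.ne ((hG u).2.injOn ⟨hi, by omega⟩ ⟨hj, hj'⟩ (hix.trans hx'.symm))
    have h1' : QueueInv start nbr S
        (fun x => d x - if ∃ i, start u ≤ i ∧ i < j ∧ nbr i = x then 1 else 0)
        (s'.setReg .w (s'.arr .adj j)) :=
      h1.of_eq (by simp) (by simp) (by simp) rfl rfl rfl rfl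
    refine (h1'.runs_setDeg (r := .w) (x := x) (by simp [h1.adj_eq, hx']) _).mono ?_
    rintro t s'' ⟨ht, hQ, hreg, hback, harr⟩
    refine ⟨by simpa [Expr.cost] using ht, by simpa [hreg] using hjs,
      (hQ.mono (Finset.subset_insert _ _) fun y hy => ?_).of_eq ?_ ?_ ?_ rfl rfl rfl rfl, ?_⟩
    · by_cases hyx : y = x
      · subst hyx
        have := h1.deg_eq y hxS
        simp only [hnew, if_false, Nat.sub_zero] at this
        simp only [hstep j y y hx' hj, true_or, if_true, Function.update_self, Expr.eval,
          Store.setReg_reg, Store.setReg_arr, h1.adj_eq, hx', this]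
      · simp only [hstep j x y hx' hj, hyx, false_or, ne_eq, not_false_eq_true,
          Function.update_of_ne]
    iterate 3 simp
    · simp at hback
      simp [hreg, harr, h2, h3, h4, h6, h7]
      omega
  · rintro t s' ⟨ht, h1, h2, h3, h4, h5, h6⟩
    refine ⟨ht, h1.mono subset_rfl fun x _ => ?_, h3, h4, h5, h6⟩
    have : (∃ i, start u ≤ i ∧ i < start (u + 1) ∧ nbr i = x) ↔ G.Adj u x := by
      constructor
      · rintro ⟨i, hi, hi', hix⟩
        obtain ⟨y, hy, hy'⟩ := hnbr i hi hi'
        rwa [show x = y from Fin.ext (hix.symm.trans hy')]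
      · intro hux
        obtain ⟨i, hi, hi'⟩ := (hG u).2.surjOn ⟨x, hux, rfl⟩
        exact ⟨i, hi.1, hi.2, hi'⟩
    simp only [this]

/-! ### Amortised analysis of the main loop. -/

/-- The potential of the set of present vertices: one for each vertex and each of the positions in
their adjacency lists. -/
def listSize (start : ℕ → ℕ) (S : Finset (Fin n)) : ℕ :=
  ∑ v ∈ S, (start (v + 1) - start v + 1)

/-- The queue invariant is required only on `S.erase v`, as the leaf `v` has just left the queue. A
position in the list of `u` costs at most 31 steps and one queue entry worth 18, whence 49 = 31 +
18; a position in the list of `v` costs only 17. The fixed costs are covered by the two units for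
`v` and `u` themselves. -/
theorem runs_removeLeaf {v : Fin n} (hG : IsAdjLists G start nbr)
    (hQ : QueueInv start nbr (S.erase v) (degIn G S) s)
    (hvert : ∀ v : Fin n, s.arr .vertex v = if v ∈ S then 1 else 0)
    (hforced : ∃ q, IsForced G S q (s.reg .k) (s.arr .fst) (s.arr .snd))
    (hv : v ∈ S) (hsv : s.reg .v = v) (hdeg : degIn G S v = 1) :
    Runs removeLeaf s fun t s' => ∃ T : Finset (Fin n), MainInv G start nbr T s' ∧
      s'.reg .front = s.reg .front ∧
      t + 18 * s'.reg .back + 49 * listSize start T ≤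
        18 * s.reg .back + 49 * listSize start S := by
  classical
  obtain ⟨q, hq⟩ := hforced
  obtain ⟨u, hu, hvu, hleaf⟩ := degIn_eq_one hdeg
  have hlist : listSize start ((S.erase v).erase u) + (start (u + 1) - start u + 1) +
      (start (v + 1) - start v + 1) = listSize start S := by
    rw [listSize, listSize, Finset.sum_erase_add, Finset.sum_erase_add _ _ hv]
    exact Finset.mem_erase.2 ⟨hvu.ne', hu⟩
  refine .seq <| (runs_findNeighbour hG hQ.start_eq hQ.adj_eq hvert hsv hu hvu hleaf).mono ?_
  rintro t₁ s₁ ⟨ht₁, harr, hsu, hreg⟩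
  refine .seq <| .write <| .seq <| .write <| .seq <| .write <| .seq <| .write <| .seq <| .set ?_
  -- At this point the vertex set has already shrunk, while the degrees are still those for `S`.
  refine (QueueInv.runs_decrement (S := (S.erase v).erase u) (d := degIn G S) (u := u) hG
    ((hQ.mono ?_ fun _ _ => rfl).of_eq ?_ ?_ ?_ ?_ ?_ ?_ ?_) ?_ ?_).mono ?_
  · exact Finset.erase_subset _ _
  iterate 7 simp [hreg, harr]
  · intro x
    simp only [Store.setReg_arr, Store.setArr_arr, Store.setArr_reg, Expr.eval, reduceCtorEq,
      if_true, if_false, hsu, hreg, ne_eq, not_false_eq_true, harr, hsv, Finset.mem_erase,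
      Function.update_apply, hvert, Fin.val_inj]
    grind
  · simpa using hsu
  · rintro t s' ⟨ht, hQ', hfront, hk, hback, hvertex, hfst, hsnd⟩
    simp only [Store.setReg_arr, Store.setArr_arr, Store.setArr_reg, Store.setReg_reg, Expr.eval,
      reduceCtorEq, if_true, if_false, hsu, hreg, ne_eq, not_false_eq_true, harr, hsv]
      at hfront hk hback hvertex hfst hsnd
    refine ⟨(S.erase v).erase u, ⟨hQ'.mono subset_rfl fun x hx => ?_, ?_, ?_⟩, hfront, ?_⟩
    · exact degIn_erase_leaf hu hleaf hx
    · intro x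
      simp only [hvertex, Finset.mem_erase, Function.update_apply, hvert, Fin.val_inj]
      grind
    · rw [hk, hfst, hsnd]
      exact ⟨_, hq.erase_leaf hv hu hvu hleaf⟩
    · simp [Expr.cost]
      omega

/-- The vertices marked as present. -/
def present (n : ℕ) (s : Store Reg Arr) : Finset (Fin n) :=
  Finset.univ.filter fun v => s.arr .vertex v = 1

theorem present_setReg (r : Reg) (x : ℕ) : present n (s.setReg r x) = present n s := rfl

theorem MainInv.present_eq (h : MainInv G start nbr S s) : present n s = S := by
  ext v
  simp [present, h.vertex]

theorem MainInv.runs_mainLoop (hG : IsAdjLists G start nbr) (h : MainInv G start nbr S s)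
    (hfront : s.reg .front = 0) :
    Runs mainLoop s fun t s' => t ≤ 18 * s.reg .back + 49 * listSize start S + 3 ∧
      ∃ T : Finset (Fin n), MainInv G start nbr T s' ∧ ∀ v ∈ T, degIn G T v ≠ 1 := by
  refine (Runs.while (fun s => ∃ T : Finset (Fin n), MainInv G start nbr T s)
    -- A round whose test fails takes exactly 18 steps. The potential must be a function of the
    -- memory, so the current vertex set is read off by `present`.
    (fun s => 18 * (s.reg .back - s.reg .front) + 49 * listSize start (present n s))
    ⟨S, h⟩ ?_).mono ?_
  · rintro s ⟨S, h⟩ hb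
    simp only [Test.holds, Expr.eval] at hb
    rw [h.present_eq]
    obtain ⟨v, hv⟩ : ∃ v : Fin n, s.arr .queue (s.reg .front) = v :=
      ⟨⟨_, h.queue.queue_lt _ hb⟩, rfl⟩
    have hpop : ∀ x ∈ S, degIn G S x = 1 → x ≠ v →
        ∃ i, s.reg .front + 1 ≤ i ∧ i < s.reg .back ∧ s.arr .queue i = x := by
      intro x hx hx1 hxv
      obtain ⟨i, hi, hi', hix⟩ := h.queue.leaf x hx hx1
      refine ⟨i, Nat.lt_of_le_of_ne hi ?_, hi', hix⟩
      rintro rfl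
      exact hxv (Fin.ext (hix.symm.trans hv))
    refine .seq <| .set <| .seq <| .set <| .ifThen ?_ ?_
    · intro ht
      simp [Test.holds, Expr.eval, hv, h.vertex] at ht
      obtain ⟨hvS, hdeg⟩ := ht
      rw [h.queue.deg_eq v hvS] at hdeg
      refine (runs_removeLeaf (S := S) (v := v) hG ⟨?_, ?_, ?_, ?_, ?_, ?_, ?_⟩ ?_ ?_ hvS ?_
        hdeg).mono ?_
      · simpa using h.queue.n_eq
      · simpa using h.queue.start_eq
      · simpa using h.queue.adj_eq
      · intro x hx
        simpa using h.queue.deg_eq x (Finset.mem_of_mem_erase hx)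
      · simpa [Expr.eval] using hb
      · simpa using h.queue.queue_lt
      · intro x hx hx1
        simpa [Expr.eval] using hpop x (Finset.mem_of_mem_erase hx) hx1 (Finset.ne_of_mem_erase hx)
      · simpa using h.vertex
      · simpa using h.forced
      · simpa [Expr.eval] using hv
      · rintro t s' ⟨T, hT, hfront, hle⟩
        refine ⟨⟨T, hT⟩, ?_⟩
        rw [hT.present_eq]
        have := hT.queue.front_le
        simp [Test.cost, Expr.cost, Expr.eval] at hfront hle ⊢
        omega
    · intro ht
      simp only [Test.holds, Expr.eval, Store.setReg_reg, Store.setReg_arr, reduceCtorEq, if_true,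
        if_false, hv, h.vertex] at ht
      have hT : MainInv G start nbr S
          ((s.setReg .v (s.arr .queue (s.reg .front))).setReg .front (s.reg .front + 1)) := by
        refine ⟨⟨?_, ?_, ?_, ?_, ?_, ?_, ?_⟩, ?_, ?_⟩
        · simpa using h.queue.n_eq
        · simpa using h.queue.start_eq
        · simpa using h.queue.adj_eq
        · simpa using h.queue.deg_eq
        · simpa using hb
        · simpa using h.queue.queue_lt
        · intro x hx hx1
          -- Discarding `v` loses no leaf, since the test has just shown that `v` is not a present
          -- vertex of degree one.
          have hxv : x ≠ v := by
            rintro rfl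
            exact ht ⟨if_pos hx, (h.queue.deg_eq x hx).trans hx1⟩
          simpa using hpop x hx hx1 hxv
        · simpa using h.vertex
        · simpa using h.forced
      refine ⟨⟨S, by simpa [Expr.eval] using hT⟩, ?_⟩
      simp [present_setReg, h.present_eq, Test.cost, Expr.cost, Expr.eval]
      omega
  · rintro t s' ⟨⟨T, hT⟩, hb, ht⟩
    simp only [Test.holds, Expr.eval] at hb
    rw [h.present_eq, hfront] at ht
    simp only [Test.cost, Expr.cost] at ht
    -- Any leaf left would still be in the queue, but the queue is empty.
    refine ⟨by omega, T, hT, fun v hv hv1 => ?_⟩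
    obtain ⟨i, hi, hi', -⟩ := hT.queue.leaf v hv hv1
    omega

/-! ### Total running time and conclusion. -/

theorem listSize_univ (hG : IsAdjLists G start nbr) :
    listSize start (Finset.univ : Finset (Fin n)) = 2 * G.edgeSet.ncard + n := by
  simp [listSize, Finset.sum_add_distrib, hG.length_eq, sum_degIn_univ]

theorem card_le_two_mul_edges (h : ∀ v, ∃ w, G.Adj v w) : n ≤ 2 * G.edgeSet.ncard := by
  classical
  rw [← sum_degIn_univ]
  calc n = ∑ _v : Fin n, 1 := by simp
    _ ≤ _ := Finset.sum_le_sum fun v _ => Finset.card_pos.2 <| by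
      obtain ⟨w, hw⟩ := h v
      exact ⟨w, by simpa using hw⟩

theorem runs_uniquePerfectMatching (hn : s.reg .n = n)
    (hG : IsAdjLists G (s.arr .start) (s.arr .adj)) :
    Runs uniquePerfectMatching s fun t s' => t ≤ 112 * n + 98 * G.edgeSet.ncard + 30 ∧
      ∃ (T : Finset (Fin n)) (q : Fin n → Fin n),
        IsForced G T q (s'.reg .k) (s'.arr .fst) (s'.arr .snd) ∧
        (∀ v ∈ T, degIn G T v ≠ 1) ∧
        (T = ∅ → s'.reg .ans = 1) ∧ (T ≠ ∅ → s'.reg .ans = 0) := by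
  refine .seq <| (runs_initVertices hn).mono ?_
  rintro t₁ s₁ ⟨ht₁, hn₁, hs₁, ha₁, hv₁⟩
  refine .seq <| (runs_initLeaves hn₁ hs₁ ha₁ hv₁).mono ?_
  rintro t₂ s₂ ⟨ht₂, hQ, hfront, hback, hv₂⟩
  refine .seq <| .set <| .seq <| (MainInv.runs_mainLoop (S := Finset.univ)
    (s := s₂.setReg .k 0) hG
    ⟨(hQ.mono subset_rfl fun v _ => ?_).of_eq ?_ ?_ ?_ rfl rfl rfl rfl, ?_, id, ?_⟩ ?_).mono ?_
  · exact (hG.length_eq v).symm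
  iterate 3 simp
  · simpa using hv₂
  · simpa [Expr.eval] using isForced_univ
  · simpa using hfront
  · rintro t₃ s₃ ⟨ht₃, T, hT, hleaf⟩
    obtain ⟨q, hq⟩ := hT.forced
    refine (runs_testEmpty hT.queue.n_eq hT.vertex).mono ?_
    rintro t₄ s₄ ⟨ht₄, harr, hk, hyes, hno⟩
    refine ⟨?_, T, q, by rwa [harr, hk], hleaf, hyes, hno⟩
    rw [listSize_univ hG] at ht₃
    simp [Expr.cost] at ht₃ ⊢
    omega

end UPM

theorem theorem4 :
    ∃ C : ℕ, ∀ (n : ℕ) (G : SimpleGraph (Fin n)) (s : UPM.Store UPM.Reg UPM.Arr),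
      UPM.IsKonigEgervary G → UPM.IsInput G s →
      ∃ (t : ℕ) (s' : UPM.Store UPM.Reg UPM.Arr),
        UPM.Exec UPM.uniquePerfectMatching s t s' ∧
        -- the answer is correct
        (s'.reg .ans = 0 ∨ s'.reg .ans = 1) ∧
        (s'.reg .ans = 1 ↔ UPM.HasUniquePerfectMatching G) ∧
        -- the unique perfect matching, if there is one, is found
        (UPM.HasUniquePerfectMatching G →
          ∀ M : G.Subgraph, M.IsPerfectMatching → UPM.IsOutput M s') ∧
        -- the running time
        ((∀ v, ∃ w, G.Adj v w) → 1 ≤ G.edgeSet.ncard → t ≤ C * G.edgeSet.ncard) ∧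
        t ≤ C * (n + G.edgeSet.ncard + 1) := by
  -- If `n ≤ 2m` and `m ≥ 1`, then `112n + 98m + 30 ≤ 352m`, so 448 = 4 · 112 leaves room to spare.
  refine ⟨448, fun n G s hKE hs => ?_⟩
  obtain ⟨t, s', hexec, ht, T, q, hq, hleaf, hyes, hno⟩ :=
    UPM.runs_uniquePerfectMatching hs.1 (G := G) hs.2.2
  have hiff : UPM.HasUniquePerfectMatching G ↔ T = ∅ :=
    hq.hasUniquePerfectMatching_iff hKE fun v hv u hu hvu =>
      UPM.exists_adj_ne_of_degIn_ne_one (hleaf v hv) hu hvu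
  refine ⟨t, s', hexec, ?_, ?_, ?_, ?_, by omega⟩
  · by_cases hT : T = ∅
    · exact .inr (hyes hT)
    · exact .inl (hno hT)
  · rw [hiff]
    refine ⟨fun h => by_contra fun hT => ?_, hyes⟩
    rw [hno hT] at h
    exact absurd h (by simp)
  · intro h M hM
    obtain rfl := hiff.1 h
    exact hq.isOutput hM
  · intro hiso hm
    have := UPM.card_le_two_mul_edges hiso
    omega
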